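/- Let $G=(V,E)$ be a finite directed graph and let $f\ge 0$ be an integer. For $F\subseteq V$ and $v\in V\setminus F$, let $\mathrm{reach}_v(F)$ be the set of all $u\in V\setminus F$ that have a directed path to $v$ in the subgraph of $G$ induced by $V\setminus F$ (in particular $v\in \mathrm{reach}_v(F)$). The graph $G$ satisfies *1-reach* if for every $F\subseteq V$ with $|F|\le f$ and all $u,v\in V\setminus F$ we have $\mathrm{reach}_u(F)\cap \mathrm{reach}_v(F)\ne\emptyset$. Consider deterministic synchronous message-passing algorithms on $G$. Each node starts with an input. In each round, each node sends a message of its choice (or none) along each of its outgoing edges, receives the messages sent to it in this round, and updates its state. At most $f$ nodes are faulty. A faulty node crashes in some round: in that round its messages reach only an arbitrary subset of its outgoing neighbours, in earlier rounds it follows the algorithm, and in later rounds it sends nothing. The algorithm may depend on $G$ and $f$. *Synchronous exact consensus is possible in $G$ in the presence of up to $f$ crash faults* if there is an algorithm such that, for all inputs and all crash behaviours with at most $f$ faulty nodes: 1. (Termination) every nonfaulty node eventually outputs a value (irrevocably); 2. (Agreement) the outputs of any two nonfaulty nodes are equal; 3. (Validity) the output of every nonfaulty node is admissible for the inputs. **Theorem.**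 (a) For real-valued inputs and outputs, where an output is admissible if it lies in the range $[\min_u x_u,\max_u x_u]$ of the inputs $x_u$ of all nodes, synchronous exact consensus is possible in $G$ in the presence of up to $f$ crash faults if and only if $G$ satisfies 1-reach. (b) The same equivalence holds for inputs and outputs in an arbitrary set with at least two elements (for instance $\{0,1\}$ or $\mathbb{R}$), where an output is admissible if it equals the input of some node. -/

import Mathlib

/-- The reach set of `v` under `F`: the nodes `u` outside `F` that have a directed path to `v`
in the subgraph of `G` induced by the complement of `F`. -/
def reachSet {V : Type} (G : Digraph V) (F : Set V) (v : V) : Set V :=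
  {u | u ∉ F ∧ Relation.ReflTransGen (fun a b => a ∉ F ∧ b ∉ F ∧ G.Adj a b) u v}

/-- The 1-reach condition with fault bound `f`. -/
def OneReach {V : Type} (G : Digraph V) (f : ℕ) : Prop :=
  ∀ F : Set V, F.ncard ≤ f → ∀ u v : V, u ∉ F → v ∉ F →
    (reachSet G F u ∩ reachSet G F v).Nonempty

/-- A deterministic synchronous message-passing algorithm for the nodes `V` with inputs and
outputs in `Val`. The code may differ from node to node. In every round a node first sends,
to each outgoing neighbour separately, a message computed from its state (`none`: it sends
nothing), and then updates its state from the messages that it has received in this round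
(`none`: nothing has arrived from that node). A node that has an output in its state outputs it;
the first output counts (see `Outputs`). -/
structure SyncAlgorithm (V Val : Type) where
  State : Type
  Msg : Type
  init : V → Val → State
  send : (sender : V) → State → (receiver : V) → Option Msg
  update : V → State → (V → Option Msg) → State
  output : V → State → Option Val

/-- The crash behaviour of all nodes in one execution. The node `u` works correctly in every
round before `crashRound u`. In round `crashRound u` it crashes while sending, so that only the
receivers in `lastReceivers u` (an arbitrary set) still get its message of that round. In later
rounds it sends nothing. A node with `crashRound u = ⊤` never crashes. -/
structure CrashPattern (V : Type) where
  crashRound : V → ℕ∞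
  lastReceivers : V → Set V

namespace CrashPattern

variable {V : Type}

/-- The nodes that crash at some time. -/
def faulty (c : CrashPattern V) : Set V := {v | c.crashRound v ≠ ⊤}

/-- In round `r`, what `u` sends to `v` leaves `u` in spite of the crash behaviour of `u`. -/
def Transmits (c : CrashPattern V) (r : ℕ) (u v : V) : Prop :=
  (r : ℕ∞) < c.crashRound u ∨ ((r : ℕ∞) = c.crashRound u ∧ v ∈ c.lastReceivers u)

end CrashPattern

namespace SyncAlgorithm

variable {V Val : Type}

open Classical in
/-- The state of each node after `r` rounds (rounds are numbered from `0`) of the execution of `A`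
in the network `G` with inputs `x` and crash pattern `c`. The value at a node that has crashed
is never observed by another node and is not constrained by any correctness property. -/
noncomputable def stateAt (A : SyncAlgorithm V Val) (G : Digraph V) (x : V → Val)
    (c : CrashPattern V) : ℕ → V → A.State
  | 0, v => A.init v (x v)
  | r + 1, v => A.update v (stateAt A G x c r v) fun u =>
      if G.Adj u v ∧ c.Transmits r u v then A.send u (stateAt A G x c r u) v else none

/-- In this execution the node `v` outputs `y` (its first, hence irrevocable, output). -/
def Outputs (A : SyncAlgorithm V Val) (G : Digraph V) (x : V → Val) (c : CrashPattern V)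
    (v : V) (y : Val) : Prop :=
  ∃ r : ℕ, A.output v (A.stateAt G x c r v) = some y ∧
    ∀ s < r, A.output v (A.stateAt G x c s v) = none

/-- `A` achieves exact consensus in `G` in every execution with at most `f` crash faults, with
respect to the validity requirement `valid`, where `valid x y` says that `y` is an admissible
output when the inputs of all nodes are `x`. -/
def SolvesExactConsensus (A : SyncAlgorithm V Val) (G : Digraph V) (f : ℕ)
    (valid : (V → Val) → Val → Prop) : Prop :=
  ∀ (x : V → Val) (c : CrashPattern V), c.faulty.ncard ≤ f →
    -- termination
    (∀ v ∉ c.faulty, ∃ y, A.Outputs G x c v y) ∧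
    -- agreement
    (∀ u ∉ c.faulty, ∀ v ∉ c.faulty, ∀ y z,
      A.Outputs G x c u y → A.Outputs G x c v z → y = z) ∧
    -- validity
    (∀ v ∉ c.faulty, ∀ y, A.Outputs G x c v y → valid x y)

end SyncAlgorithm

/-- Some algorithm achieves synchronous exact consensus in `G` with up to `f` crash faults. The
algorithm may depend on `G` and `f`, but not on the inputs or on who crashes. -/
def SyncCrashExactConsensusPossible {V Val : Type} (G : Digraph V) (f : ℕ)
    (valid : (V → Val) → Val → Prop) : Prop :=
  ∃ A : SyncAlgorithm V Val, A.SolvesExactConsensus G f valid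

/-- Validity for crash faults, general values: the output is the input of some node. -/
def InputValidity {V Val : Type} (x : V → Val) (y : Val) : Prop := ∃ u, x u = y

/-- Validity for crash faults, real values: the output is in the range of the inputs. -/
def RangeValidity {V : Type} (x : V → ℝ) (y : ℝ) : Prop := (∃ u, x u ≤ y) ∧ ∃ w, y ≤ x w

/-!
Necessity. Suppose that `F` has at most `f` nodes and that `u` and `v` have disjoint reach sets
under `F`. Let the nodes of `F` crash silently in the very first round. A node of
`reachSet G F u` then hears from no node outside of this set, so the states in it depend on the
inputs in it only (`stateAt_congr_of_reachSet`). With input `a` on `reachSet G F u` and `b`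
elsewhere, `u` decides as if all inputs were `a` and `v` as if all were `b`, so they disagree
(`oneReach_of_possible`).

Sufficiency. Fix a linear order on the values and let the nodes flood values: in each of `f + 1`
phases, for `L` rounds every node replaces its value by the minimum of its own value and those that
it has received, and then for `L` rounds by the maximum; `L` bounds the length of the paths that
are needed. As there are at most `f` faults, no node crashes in some phase
(`exists_crashFree_phase`). Let `F` be the set of the nodes that have crashed before it. Under
1-reach some node `s` reaches all nodes outside of `F` (`OneReach.exists_root`). After the minimum
rounds the value of `s` is an upper bound for all values outside of `F`, since it has come from a
node that reaches `s` and hence every node. In the maximum rounds `s` spreads this upper bound to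
everyone, so all values become equal (`agree_of_crashFree`), and they remain equal from then on
(`agree_mono`). All values are inputs of some node throughout, which gives both kinds of validity.
-/

/-! ### Necessity of 1-reach -/

/-- The crash pattern in which the nodes of `F` crash in the first round without sending anything,
and the other nodes never crash. -/
noncomputable def CrashPattern.initiallyDead {V : Type} (F : Set V) : CrashPattern V :=
  open Classical in ⟨fun v => if v ∈ F then 0 else ⊤, fun _ => ∅⟩

namespace CrashPattern

variable {V : Type}

theorem faulty_initiallyDead (F : Set V) : (initiallyDead F).faulty = F := by
  ext v
  by_cases h : v ∈ F <;> simp [faulty, initiallyDead, h]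

theorem notMem_of_transmits_initiallyDead {F : Set V} {r : ℕ} {u v : V}
    (h : (initiallyDead F).Transmits r u v) : u ∉ F := by
  intro hu
  simp [Transmits, initiallyDead, hu] at h

end CrashPattern

/-- When the nodes of `F` are dead from the start, the states of the nodes in a reach set under
`F` depend only on the inputs of the nodes in this reach set. -/
theorem SyncAlgorithm.stateAt_congr_of_reachSet {V Val : Type} (A : SyncAlgorithm V Val)
    (G : Digraph V) {F : Set V} {w : V} {x x' : V → Val}
    (hx : ∀ v ∈ reachSet G F w, x v = x' v) (r : ℕ) :
    ∀ v ∈ reachSet G F w, A.stateAt G x (.initiallyDead F) r v =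
      A.stateAt G x' (.initiallyDead F) r v := by
  induction r with
  | zero => intro v hv; simp [stateAt, hx v hv]
  | succ r ih =>
    intro v hv
    simp only [stateAt, ih v hv]
    congr 1
    ext1 u
    split_ifs with h
    · have hu := CrashPattern.notMem_of_transmits_initiallyDead h.2
      rw [ih u ⟨hu, .head ⟨hu, hv.1, h.1⟩ hv.2⟩]
    · rfl

theorem SyncAlgorithm.Outputs.congr {V Val : Type} {A : SyncAlgorithm V Val} {G : Digraph V}
    {x x' : V → Val} {c : CrashPattern V} {v : V} {y : Val} (h : A.Outputs G x c v y)
    (hs : ∀ r, A.stateAt G x c r v = A.stateAt G x' c r v) : A.Outputs G x' c v y := by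
  simpa only [Outputs, hs] using h

/-- Only one property of the validity requirement is needed: when all nodes have the same input,
this input is the only admissible output. -/
theorem oneReach_of_possible {V Val : Type} [Nontrivial Val] {G : Digraph V} {f : ℕ}
    {valid : (V → Val) → Val → Prop} (hvalid : ∀ a y, valid (fun _ => a) y → y = a)
    (h : SyncCrashExactConsensusPossible G f valid) : OneReach G f := by
  classical
  obtain ⟨A, hA⟩ := h
  obtain ⟨a, b, hab⟩ := exists_pair_ne Val
  intro F hF u v hu hv
  by_contra hdisj
  rw [Set.not_nonempty_iff_eq_empty, ← Set.disjoint_iff_inter_eq_empty,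
    Set.disjoint_left] at hdisj
  have hF' : (CrashPattern.initiallyDead F).faulty = F := CrashPattern.faulty_initiallyDead F
  have hcard : (CrashPattern.initiallyDead F).faulty.ncard ≤ f := by rwa [hF']
  have outputs_const : ∀ d : Val, ∀ w ∉ F,
      A.Outputs G (fun _ => d) (.initiallyDead F) w d := by
    intro d w hw
    obtain ⟨hterm, -, hval⟩ := hA (fun _ => d) _ hcard
    rw [hF'] at hterm hval
    obtain ⟨y, hy⟩ := hterm w hw
    exact hvalid d y (hval w hw y hy) ▸ hy
  let x : V → Val := fun w => if w ∈ reachSet G F u then a else b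
  have hua : A.Outputs G x (.initiallyDead F) u a :=
    (outputs_const a u hu).congr fun r =>
      A.stateAt_congr_of_reachSet G (w := u) (fun w hw => by simp [x, hw]) r u ⟨hu, .refl⟩
  have hvb : A.Outputs G x (.initiallyDead F) v b :=
    (outputs_const b v hv).congr fun r =>
      A.stateAt_congr_of_reachSet G (w := v)
        (fun w hw => (if_neg fun h => hdisj h hw).symm) r v ⟨hv, .refl⟩
  refine hab ((hA x _ hcard).2.1 u ?_ v ?_ a b hua hvb) <;> rwa [hF']

/-! ### Roots and path lengths -/

/-- Under 1-reach, some node reaches all nodes outside of `F`: a node whose reach set has the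
smallest size. -/
theorem OneReach.exists_root {V : Type} [Finite V] {G : Digraph V} {f : ℕ} (h : OneReach G f)
    {F : Set V} (hF : F.ncard ≤ f) (hne : Fᶜ.Nonempty) :
    ∃ s ∉ F, ∀ v ∉ F, s ∈ reachSet G F v := by
  obtain ⟨s, hs, hmin⟩ :=
    Set.exists_min_image Fᶜ (fun v => (reachSet G F v).ncard) (Set.toFinite _) hne
  refine ⟨s, hs, fun v hv => ?_⟩
  obtain ⟨w, hws, hwv⟩ := h F hF s v hs hv
  have hsub : reachSet G F w ⊆ reachSet G F s := fun u hu => ⟨hu.1, hu.2.trans hws.2⟩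
  have heq : reachSet G F w = reachSet G F s :=
    Set.eq_of_subset_of_ncard_le hsub (hmin w hws.1) (Set.toFinite _)
  have hsw : s ∈ reachSet G F w := heq ▸ ⟨hs, .refl⟩
  exact ⟨hs, hsw.2.trans hwv.2⟩

/-- `RelatedWithin R k a b`: there is an `R`-path of length at most `k` from `a` to `b`
(encoded as a path of exactly `k` steps, each of which may stay in place). -/
def RelatedWithin {α : Type} (R : α → α → Prop) : ℕ → α → α → Prop
  | 0, a, b => a = b
  | k + 1, a, b => ∃ d, RelatedWithin R k a d ∧ (d = b ∨ R d b)

theorem RelatedWithin.mono {α : Type} {R : α → α → Prop} {k l : ℕ} {a b : α} (hkl : k ≤ l)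
    (h : RelatedWithin R k a b) : RelatedWithin R l a b := by
  induction hkl with
  | refl => exact h
  | step _ ih => exact ⟨b, ih, .inl rfl⟩

theorem exists_relatedWithin {α : Type} {R : α → α → Prop} {a b : α}
    (h : Relation.ReflTransGen R a b) : ∃ k, RelatedWithin R k a b := by
  induction h with
  | refl => exact ⟨0, rfl⟩
  | tail _ hR ih =>
    obtain ⟨k, hk⟩ := ih
    exact ⟨k + 1, _, hk, .inr hR⟩

/-- The edges of the subgraph of `G` induced by the complement of `F`. -/
def AdjOutside {V : Type} (G : Digraph V) (F : Set V) (a b : V) : Prop :=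
  a ∉ F ∧ b ∉ F ∧ G.Adj a b

/-- There are only finitely many sets `F` and pairs of nodes, so one bound on path lengths serves
for all of them. -/
theorem exists_path_bound {V : Type} [Finite V] (G : Digraph V) :
    ∃ L, ∀ (F : Set V) (u v : V), u ∈ reachSet G F v →
      RelatedWithin (AdjOutside G F) L u v := by
  have hk : ∀ p : Set V × V × V, ∃ k, p.2.1 ∈ reachSet G p.1 p.2.2 →
      RelatedWithin (AdjOutside G p.1) k p.2.1 p.2.2 := by
    intro p
    by_cases hp : p.2.1 ∈ reachSet G p.1 p.2.2
    · obtain ⟨k, hk⟩ := exists_relatedWithin hp.2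
      exact ⟨k, fun _ => hk⟩
    · exact ⟨0, fun h => absurd h hp⟩
  choose k hk using hk
  obtain ⟨L, hL⟩ := Finite.bddAbove_range k
  refine ⟨L, fun F u v h => (hk (F, u, v) h).mono (hL ⟨_, rfl⟩)⟩

/-! ### Crash-free phases -/

section CrashFree

variable {V : Type} {c : CrashPattern V}

/-- There are more phases than faulty nodes, so in some phase no node crashes. -/
theorem exists_crashFree_phase [Finite V] {L f : ℕ} (hc : c.faulty.ncard ≤ f) :
    ∃ i ≤ f, ∀ v, c.crashRound v < (2 * L * i : ℕ) ∨
      ((2 * L * (i + 1) : ℕ) : ℕ∞) ≤ c.crashRound v := by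
  by_contra! hcon
  -- A node that crashes in round `r` crashes in phase `r / (2 * L)`.
  have hsub : (Set.Iic f : Set ℕ) ⊆ (fun v => (c.crashRound v).toNat / (2 * L)) '' c.faulty := by
    intro i hi
    obtain ⟨v, h1, h2⟩ := hcon i hi
    have hv : c.crashRound v ≠ ⊤ := h2.ne_top
    refine ⟨v, hv, ?_⟩
    obtain ⟨k, hk⟩ := ENat.ne_top_iff_exists.1 hv
    rw [← hk, Nat.cast_le] at h1
    rw [← hk, Nat.cast_lt] at h2
    simp only [← hk, ENat.toNat_natCast]
    exact Nat.div_eq_of_lt_le (by linarith) (by linarith)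
  have h1 := Set.ncard_le_ncard hsub (Set.toFinite _)
  have h2 := Set.ncard_image_le (f := fun v => (c.crashRound v).toNat / (2 * L))
    (Set.toFinite c.faulty)
  have h3 : (Set.Iic f : Set ℕ).ncard = f + 1 := by
    rw [← Finset.coe_Iic, Set.ncard_coe_finset, Nat.card_Iic]
  omega

/-- In the rounds from `t` to `t + k - 1`, the nodes of `F` are dead and the others transmit
everything. -/
def QuietDuring (c : CrashPattern V) (F : Set V) (t k : ℕ) : Prop :=
  ∀ j < k, ∀ u v, c.Transmits (t + j) u v ↔ u ∉ F

theorem QuietDuring.mono {F : Set V} {t k l : ℕ} (h : QuietDuring c F t l) (hkl : k ≤ l) :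
    QuietDuring c F t k :=
  fun j hj => h j (hj.trans_le hkl)

theorem quietDuring_of_crashRound {t k : ℕ}
    (h : ∀ v, c.crashRound v < t ∨ ((t + k : ℕ) : ℕ∞) ≤ c.crashRound v) :
    QuietDuring c {v | c.crashRound v < t} t k := by
  intro j hj u v
  rw [Set.mem_ofPred_eq, not_lt]
  constructor
  · intro hT
    exact le_trans (by exact_mod_cast t.le_add_right j) (hT.elim le_of_lt fun h => h.1.le)
  · intro hu
    exact .inl (lt_of_lt_of_le (by exact_mod_cast (by omega)) ((h u).resolve_left hu.not_gt))

end CrashFree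

/-! ### The min-max flooding algorithm -/

section Flooding

variable {V Val : Type} [Fintype V] [LinearOrder Val]

/-- The value `own` together with the values received in the messages `m`. -/
def knownValues (own : Val) (m : V → Option Val) : Finset Val :=
  insert own (Finset.univ.biUnion fun u => (m u).toFinset)

theorem mem_knownValues {own y : Val} {m : V → Option Val} :
    y ∈ knownValues own m ↔ y = own ∨ ∃ u, m u = some y := by
  simp [knownValues]

theorem knownValues_nonempty (own : Val) (m : V → Option Val) : (knownValues own m).Nonempty :=
  ⟨own, mem_knownValues.2 (.inl rfl)⟩

/-- Min-max flooding with `f + 1` phases, each of `L` minimum rounds and `L` maximum rounds. The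
state consists of the number of the round and the current value, which is sent to all outgoing
neighbours, and is output after the last phase. -/
def minMaxFlooding (L f : ℕ) : SyncAlgorithm V Val where
  State := ℕ × Val
  Msg := Val
  init _ a := (0, a)
  send _ s _ := some s.2
  update _ s m :=
    (s.1 + 1, if s.1 % (2 * L) < L then (knownValues s.2 m).min' (knownValues_nonempty _ _)
      else (knownValues s.2 m).max' (knownValues_nonempty _ _))
  output _ s := if s.1 = 2 * L * (f + 1) then some s.2 else none

variable (L f : ℕ) (G : Digraph V) (x : V → Val) (c : CrashPattern V)

/-- The value of the node `v` after `r` rounds of min-max flooding. -/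
noncomputable def valueAt (r : ℕ) (v : V) : Val :=
  ((minMaxFlooding L f).stateAt G x c r v).2

theorem stateAt_minMaxFlooding (r : ℕ) (v : V) :
    (minMaxFlooding L f).stateAt G x c r v = (r, valueAt L f G x c r v) := by
  refine Prod.ext ?_ rfl
  induction r generalizing v with
  | zero => rfl
  | succ r ih => exact congrArg (· + 1) (ih v)

open Classical in
/-- The values that `v` knows at the end of round `r`, before it chooses among them. -/
noncomputable def knownAt (r : ℕ) (v : V) : Finset Val :=
  knownValues (valueAt L f G x c r v) fun u =>
    if G.Adj u v ∧ c.Transmits r u v then some (valueAt L f G x c r u) else none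

variable {L f G x c}

theorem mem_knownAt {r : ℕ} {v : V} {y : Val} :
    y ∈ knownAt L f G x c r v ↔ y = valueAt L f G x c r v ∨
      ∃ u, (G.Adj u v ∧ c.Transmits r u v) ∧ valueAt L f G x c r u = y := by
  simp [knownAt, mem_knownValues]

theorem valueAt_succ (r : ℕ) (v : V) : valueAt L f G x c (r + 1) v =
    if r % (2 * L) < L then (knownAt L f G x c r v).min' (knownValues_nonempty _ _)
      else (knownAt L f G x c r v).max' (knownValues_nonempty _ _) := by
  -- The left-hand side unfolds to the same expression with the stored round number for `r`.
  exact congrArg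
    (fun n : ℕ => if n % (2 * L) < L then (knownAt L f G x c r v).min' (knownValues_nonempty _ _)
      else (knownAt L f G x c r v).max' (knownValues_nonempty _ _))
    (congrArg Prod.fst (stateAt_minMaxFlooding L f G x c r v))

theorem valueAt_succ_mem (r : ℕ) (v : V) :
    valueAt L f G x c (r + 1) v ∈ knownAt L f G x c r v := by
  rw [valueAt_succ]
  split_ifs
  · exact Finset.min'_mem _ _
  · exact Finset.max'_mem _ _

theorem valueAt_succ_le {r : ℕ} (hr : r % (2 * L) < L) {v : V} {y : Val}
    (hy : y ∈ knownAt L f G x c r v) : valueAt L f G x c (r + 1) v ≤ y := by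
  rw [valueAt_succ, if_pos hr]
  exact Finset.min'_le _ _ hy

theorem le_valueAt_succ {r : ℕ} (hr : ¬ r % (2 * L) < L) {v : V} {y : Val}
    (hy : y ∈ knownAt L f G x c r v) : y ≤ valueAt L f G x c (r + 1) v := by
  rw [valueAt_succ, if_neg hr]
  exact Finset.le_max' _ _ hy

theorem outputs_minMaxFlooding_iff {v : V} {y : Val} :
    (minMaxFlooding L f).Outputs G x c v y ↔ y = valueAt L f G x c (2 * L * (f + 1)) v := by
  simp only [SyncAlgorithm.Outputs, stateAt_minMaxFlooding]
  simp only [minMaxFlooding]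
  constructor
  · rintro ⟨r, hr, -⟩
    split_ifs at hr with h
    rw [← h]
    exact (Option.some.inj hr).symm
  · rintro rfl
    exact ⟨_, if_pos rfl, fun s hs => if_neg hs.ne⟩

/-- Every value is the input of some node. -/
theorem exists_input_eq_valueAt (r : ℕ) (v : V) : ∃ u, x u = valueAt L f G x c r v := by
  induction r generalizing v with
  | zero => exact ⟨v, rfl⟩
  | succ r ih =>
    rcases mem_knownAt.1 (valueAt_succ_mem (L := L) (f := f) (G := G) (x := x) (c := c) r v) with
      h | ⟨u, -, h⟩
    · rw [h]
      exact ih v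
    · rw [← h]
      exact ih u

/-! ### Agreement is preserved -/

/-- If all nodes that are alive at the beginning of round `t` have the value `y`, then so do those
that are alive at any later time: only nodes that were alive at the beginning of a round can have
transmitted a message in it. -/
theorem agree_mono {t t' : ℕ} (htt' : t ≤ t') {y : Val}
    (h : ∀ v, (t : ℕ∞) ≤ c.crashRound v → valueAt L f G x c t v = y) :
    ∀ v, (t' : ℕ∞) ≤ c.crashRound v → valueAt L f G x c t' v = y := by
  induction htt' with
  | refl => exact h
  | @step r _ ih =>
    intro v hv
    rcases mem_knownAt.1 (valueAt_succ_mem (L := L) (f := f) (G := G) (x := x) (c := c) r v) with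
      h | ⟨u, ⟨-, hT⟩, h⟩
    · rw [h]
      exact ih v (le_trans (by exact_mod_cast r.le_succ) hv)
    · rw [← h]
      exact ih u (hT.elim le_of_lt fun h => h.1.le)

/-! ### A crash-free phase creates agreement -/

variable {F : Set V} {t : ℕ}

theorem exists_source_of_quiet {k : ℕ} (hq : QuietDuring c F t k) :
    ∀ v ∉ F, ∃ u ∈ reachSet G F v, valueAt L f G x c (t + k) v = valueAt L f G x c t u := by
  induction k with
  | zero => exact fun v hv => ⟨v, ⟨hv, .refl⟩, rfl⟩
  | succ k ih =>
    intro v hv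
    have ih := ih (hq.mono k.le_succ)
    rcases mem_knownAt.1
      (valueAt_succ_mem (L := L) (f := f) (G := G) (x := x) (c := c) (t + k) v) with
      h | ⟨w, ⟨hadj, hT⟩, h⟩
    · obtain ⟨u, hu, hval⟩ := ih v hv
      exact ⟨u, hu, h.trans hval⟩
    · have hw : w ∉ F := (hq k k.lt_succ_self w v).1 hT
      obtain ⟨u, hu, hval⟩ := ih w hw
      exact ⟨u, ⟨hu.1, hu.2.tail ⟨hw, hv, hadj⟩⟩, h.symm.trans hval⟩

/-- In a quiet round, a node outside of `F` knows the values of its in-neighbours outside of `F`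
and its own. -/
theorem valueAt_mem_knownAt {k j : ℕ} (hq : QuietDuring c F t k) (hj : j < k) {u v : V}
    (h : u = v ∨ AdjOutside G F u v) :
    valueAt L f G x c (t + j) u ∈ knownAt L f G x c (t + j) v := by
  rw [mem_knownAt]
  rcases h with rfl | ⟨hu, -, hadj⟩
  · exact .inl rfl
  · exact .inr ⟨u, ⟨hadj, (hq j hj u v).2 hu⟩, rfl⟩

theorem valueAt_le_of_relatedWithin {k : ℕ} (hq : QuietDuring c F t k)
    (hmin : ∀ j < k, (t + j) % (2 * L) < L) {u v : V}
    (h : RelatedWithin (AdjOutside G F) k u v) :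
    valueAt L f G x c (t + k) v ≤ valueAt L f G x c t u := by
  induction k generalizing v with
  | zero => obtain rfl : u = v := h; exact le_rfl
  | succ k ih =>
    obtain ⟨w, hw, hwv⟩ := h
    exact (valueAt_succ_le (hmin k k.lt_succ_self)
      (valueAt_mem_knownAt hq k.lt_succ_self hwv)).trans
      (ih (hq.mono k.le_succ) (fun j hj => hmin j (hj.trans k.lt_succ_self)) hw)

theorem le_valueAt_of_relatedWithin {k : ℕ} (hq : QuietDuring c F t k)
    (hmax : ∀ j < k, ¬ (t + j) % (2 * L) < L) {u v : V}
    (h : RelatedWithin (AdjOutside G F) k u v) :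
    valueAt L f G x c t u ≤ valueAt L f G x c (t + k) v := by
  induction k generalizing v with
  | zero => obtain rfl : u = v := h; exact le_rfl
  | succ k ih =>
    obtain ⟨w, hw, hwv⟩ := h
    exact (ih (hq.mono k.le_succ) (fun j hj => hmax j (hj.trans k.lt_succ_self)) hw).trans
      (le_valueAt_succ (hmax k k.lt_succ_self) (valueAt_mem_knownAt hq k.lt_succ_self hwv))

/-- At the end of a phase in which no node crashes, all nodes that are still alive have the value
that the root `s` has after the minimum rounds of this phase. -/
theorem agree_of_crashFree
    (hL : ∀ (F : Set V) (u v : V), u ∈ reachSet G F v → RelatedWithin (AdjOutside G F) L u v)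
    {i : ℕ} {s : V} (hs : ∀ v ∉ F, s ∈ reachSet G F v) (hsF : s ∉ F)
    (hq : QuietDuring c F (2 * L * i) (2 * L)) :
    ∀ v ∉ F, valueAt L f G x c (2 * L * (i + 1)) v = valueAt L f G x c (2 * L * i + L) s := by
  have hq₁ : QuietDuring c F (2 * L * i) L := hq.mono (by omega)
  have hq₂ : QuietDuring c F (2 * L * i + L) L := by
    intro j hj
    have := hq (L + j) (by omega)
    rwa [← add_assoc] at this
  have hmin : ∀ j < L, (2 * L * i + j) % (2 * L) < L := by
    intro j hj
    rwa [Nat.mul_add_mod, Nat.mod_eq_of_lt (by omega)]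
  have hmax : ∀ j < L, ¬ (2 * L * i + L + j) % (2 * L) < L := by
    intro j hj
    rw [add_assoc, Nat.mul_add_mod, Nat.mod_eq_of_lt (by omega)]
    omega
  have hbound : ∀ v ∉ F,
      valueAt L f G x c (2 * L * i + L) v ≤ valueAt L f G x c (2 * L * i + L) s := by
    intro v hv
    obtain ⟨u, hu, hval⟩ := exists_source_of_quiet (L := L) (f := f) (G := G) (x := x) hq₁ s hsF
    rw [hval]
    exact valueAt_le_of_relatedWithin hq₁ hmin (hL F u v ⟨hu.1, hu.2.trans (hs v hv).2⟩)
  intro v hv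
  rw [show 2 * L * (i + 1) = 2 * L * i + L + L by ring]
  apply le_antisymm
  · obtain ⟨u, hu, hval⟩ := exists_source_of_quiet (L := L) (f := f) (G := G) (x := x) hq₂ v hv
    rw [hval]
    exact hbound u hu.1
  · exact le_valueAt_of_relatedWithin hq₂ hmax (hL F s v (hs v hv))

end Flooding

/-! ### Sufficiency of 1-reach -/

theorem OneReach.possible {V : Type} [Finite V] {G : Digraph V} {f : ℕ} (h : OneReach G f)
    (Val : Type) :
    SyncCrashExactConsensusPossible G f (InputValidity (V := V) (Val := Val)) := by
  classical
  have := Fintype.ofFinite V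
  let _ : LinearOrder Val := IsWellOrder.linearOrder WellOrderingRel
  obtain ⟨L, hL⟩ := exists_path_bound G
  refine ⟨minMaxFlooding L f, fun x c hc => ⟨fun v _ => ⟨_, outputs_minMaxFlooding_iff.2 rfl⟩,
    fun u hu v hv y z hy hz => ?_, fun v _ y hy => ?_⟩⟩
  · rw [outputs_minMaxFlooding_iff] at hy hz
    obtain ⟨i, hi, hfree⟩ := exists_crashFree_phase (L := L) hc
    let F : Set V := {v | c.crashRound v < (2 * L * i : ℕ)}
    have hsub : F ⊆ c.faulty := fun v (hv : _ < _) => hv.ne_top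
    obtain ⟨s, hsF, hs⟩ := h.exists_root ((Set.ncard_le_ncard hsub (Set.toFinite _)).trans hc)
      ⟨u, fun h => hu (hsub h)⟩
    have hq : QuietDuring c F (2 * L * i) (2 * L) :=
      quietDuring_of_crashRound (by simpa only [mul_add, mul_one] using hfree)
    have hagree := agree_of_crashFree (f := f) (x := x) hL hs hsF hq
    have hfinal := agree_mono (t' := 2 * L * (f + 1)) (Nat.mul_le_mul_left _ (by omega))
      (fun v hv => hagree v fun hvF : _ < _ => absurd (hvF.trans_le (le_trans
        (by exact_mod_cast Nat.mul_le_mul_left _ i.le_succ) hv)) (lt_irrefl _))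
    have halive : ∀ w ∉ c.faulty, ((2 * L * (f + 1) : ℕ) : ℕ∞) ≤ c.crashRound w := by
      intro w hw
      rw [not_not.1 hw]
      exact le_top
    rw [hy, hz, hfinal u (halive u hu), hfinal v (halive v hv)]
  · rw [outputs_minMaxFlooding_iff.1 hy]
    exact exists_input_eq_valueAt _ v

theorem InputValidity.rangeValidity {V : Type} {x : V → ℝ} {y : ℝ} (h : InputValidity x y) :
    RangeValidity x y := by
  obtain ⟨u, hu⟩ := h
  exact ⟨⟨u, hu.le⟩, u, hu.ge⟩

theorem mainTheorem6 {V : Type} [Finite V] (G : Digraph V) (f : ℕ) :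
    (SyncCrashExactConsensusPossible G f (RangeValidity (V := V)) ↔ OneReach G f) ∧
    ∀ (Val : Type) [Nontrivial Val],
      (SyncCrashExactConsensusPossible G f (InputValidity (V := V) (Val := Val)) ↔
        OneReach G f) := by
  refine ⟨⟨oneReach_of_possible ?_, fun h => ?_⟩,
    fun Val _ => ⟨oneReach_of_possible ?_, fun h => h.possible Val⟩⟩
  · rintro a y ⟨⟨_, h₁⟩, _, h₂⟩
    exact le_antisymm h₂ h₁
  · obtain ⟨A, hA⟩ := h.possible ℝ
    exact ⟨A, fun x c hc => ⟨(hA x c hc).1, (hA x c hc).2.1,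
      fun v hv y hy => ((hA x c hc).2.2 v hv y hy).rangeValidity⟩⟩
  · rintro a y ⟨_, h⟩
    exact h.symm
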